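/- Let $A \in \mathbb{R}^{d\times d}$ be symmetric (possibly indefinite and/or singular) and $b \in \mathbb{R}^d$. For $k \ge 0$ let $\mathcal{K}_k(A,b) = \mathrm{span}\{b, Ab, \dots, A^{k-1}b\}$, and let $g$ be the grade of $b$ with respect to $A$, i.e. the positive integer such that $\dim \mathcal{K}_k(A,b) = k$ for $k \le g$ and $\dim \mathcal{K}_k(A,b) = g$ for $k > g$. MINRES applied to $\min_{x} \|Ax-b\|^2$ is the following iteration. Set $\beta_1 = \|b\|$, $v_1 = b/\beta_1$, $v_0 = x_0 = d_0 = d_{-1} = 0$, $c_0 = -1$, $s_0 = 0$, $\phi_0 = \beta_1$, $\delta^{(1)}_1 = 0$. For $k = 1, 2, \dots$, compute $$\alpha_k = v_k^{\top} A v_k,\qquad p_k = A v_k - \beta_k v_{k-1} - \alpha_k v_k,\qquad \beta_{k+1} = \|p_k\|,$$ $$\delta^{(2)}_k = c_{k-1}\delta^{(1)}_k + s_{k-1}\alpha_k,\quad \gamma^{(1)}_k = s_{k-1}\delta^{(1)}_k - c_{k-1}\alpha_k,\quad \epsilon_{k+1} = s_{k-1}\beta_{k+1},\quad \delta^{(1)}_{k+1}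 = -c_{k-1}\beta_{k+1},$$ and $\gamma^{(2)}_k = \sqrt{(\gamma^{(1)}_k)^2 + \beta_{k+1}^2}$. If $\gamma^{(2)}_k = 0$, set $x_k = x_{k-1}$ and stop. Otherwise set $$c_k = \gamma^{(1)}_k/\gamma^{(2)}_k,\quad s_k = \beta_{k+1}/\gamma^{(2)}_k,\quad \tau_k = c_k\phi_{k-1},\quad \phi_k = s_k\phi_{k-1},$$ $$d_k = \bigl(v_k - \delta^{(2)}_k d_{k-1} - \epsilon_k d_{k-2}\bigr)/\gamma^{(2)}_k,\qquad x_k = x_{k-1} + \tau_k d_k$$ (with $\epsilon_1 = 0$), and then stop if $\beta_{k+1} = 0$, and otherwise put $v_{k+1} = p_k/\beta_{k+1}$ and continue. Write $r_k = b - A x_k$ for the residual at iteration $k$. The nonpositive curvature (NPC) condition is detected at iteration $k$ if $c_{k-1}\gamma^{(1)}_k \ge 0$. **Theorem.** Let $1 \le k < g$ and suppose that the NPC condition has not been detected at any of the iterations $1, \dots, k$, i.e. $c_{i-1}\gamma^{(1)}_i < 0$ for all $1 \le i \le k$. Then $$x_k^{\top} b - x_k^{\top} A x_k > 0,$$ $$x_k^{\top}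 r_k > x_{k-1}^{\top} r_k \ge 0,$$ $$x_k^{\top} r_{k-1} > x_k^{\top} r_k > 0,$$ and the equality $x_{k-1}^{\top} r_k = 0$ holds if and only if $k = 1$. -/

import Mathlib

noncomputable section

namespace Minres

/-- The matrix-vector product `A v` on `ℝ^d` with its Euclidean structure. -/
def mulVec {d : ℕ} (A : Matrix (Fin d) (Fin d) ℝ) (v : EuclideanSpace ℝ (Fin d)) :
    EuclideanSpace ℝ (Fin d) :=
  Matrix.toEuclideanLin A v

/-- The Krylov subspace `K_k(A, b) = span {b, A b, …, A^(k-1) b}`. -/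
def krylov {d : ℕ} (A : Matrix (Fin d) (Fin d) ℝ) (b : EuclideanSpace ℝ (Fin d)) (k : ℕ) :
    Submodule ℝ (EuclideanSpace ℝ (Fin d)) :=
  Submodule.span ℝ ((fun i : ℕ => mulVec (A ^ i) b) '' Set.Iio k)

/-- `g` is the grade of `b` with respect to `A`: the positive integer such that
`dim K_k(A, b) = k` for `k ≤ g` and `dim K_k(A, b) = g` for `k > g`. -/
def IsGrade {d : ℕ} (A : Matrix (Fin d) (Fin d) ℝ) (b : EuclideanSpace ℝ (Fin d)) (g : ℕ) :
    Prop :=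
  0 < g ∧ ∀ k : ℕ, Module.finrank ℝ (krylov A b k) = if k ≤ g then k else g

/-- The variables held by the MINRES algorithm after `k` completed iterations. -/
structure State (d : ℕ) where
  /-- `v_{k+1}` -/
  v : EuclideanSpace ℝ (Fin d)
  /-- `v_k` -/
  vPrev : EuclideanSpace ℝ (Fin d)
  /-- `β_{k+1}` -/
  beta : ℝ
  /-- `δ^{(1)}_{k+1}` -/
  delta1 : ℝ
  /-- `ε_{k+1}` -/
  eps : ℝ
  /-- `c_k` -/
  c : ℝ
  /-- `s_k` -/
  s : ℝ
  /-- `φ_k` -/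
  phi : ℝ
  /-- `τ_k` -/
  tau : ℝ
  /-- `d_k` -/
  dir : EuclideanSpace ℝ (Fin d)
  /-- `d_{k-1}` -/
  dirPrev : EuclideanSpace ℝ (Fin d)
  /-- the iterate `x_k` -/
  x : EuclideanSpace ℝ (Fin d)
  /-- the recursively updated vector `r_k` -/
  r : EuclideanSpace ℝ (Fin d)
  /-- whether the algorithm has returned `x_k` as a solution -/
  halted : Bool

/-- Initialization, `k = 0` (`ε_1` is only ever multiplied by `d_{-1} = 0`). -/
def init {d : ℕ} (b : EuclideanSpace ℝ (Fin d)) : State d where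
  v := ‖b‖⁻¹ • b
  vPrev := 0
  beta := ‖b‖
  delta1 := 0
  eps := 0
  c := -1
  s := 0
  phi := ‖b‖
  tau := ‖b‖
  dir := 0
  dirPrev := 0
  x := 0
  r := b
  halted := false

/-! The quantities computed in iteration `k`, from the state left by iteration `k - 1`. -/

/-- `α_k = v_kᵀ A v_k`. -/
def alpha {d : ℕ} (A : Matrix (Fin d) (Fin d) ℝ) (st : State d) : ℝ :=
  inner ℝ st.v (mulVec A st.v)

/-- `p_k = A v_k - β_k v_{k-1} - α_k v_k`. -/
def p {d : ℕ} (A : Matrix (Fin d) (Fin d) ℝ) (st : State d) : EuclideanSpace ℝ (Fin d) :=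
  mulVec A st.v - st.beta • st.vPrev - alpha A st • st.v

/-- `β_{k+1} = ‖p_k‖`. -/
def betaNext {d : ℕ} (A : Matrix (Fin d) (Fin d) ℝ) (st : State d) : ℝ :=
  ‖p A st‖

/-- `δ^{(2)}_k = c_{k-1} δ^{(1)}_k + s_{k-1} α_k`. -/
def delta2 {d : ℕ} (A : Matrix (Fin d) (Fin d) ℝ) (st : State d) : ℝ :=
  st.c * st.delta1 + st.s * alpha A st

/-- `γ^{(1)}_k = s_{k-1} δ^{(1)}_k - c_{k-1} α_k`. -/
def gamma1 {d : ℕ} (A : Matrix (Fin d) (Fin d) ℝ) (st : State d) : ℝ :=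
  st.s * st.delta1 - st.c * alpha A st

/-- `γ^{(2)}_k = √((γ^{(1)}_k)² + β_{k+1}²)`. -/
def gamma2 {d : ℕ} (A : Matrix (Fin d) (Fin d) ℝ) (st : State d) : ℝ :=
  Real.sqrt (gamma1 A st ^ 2 + betaNext A st ^ 2)

/-- `c_k = γ^{(1)}_k / γ^{(2)}_k` (used if `γ^{(2)}_k ≠ 0`). -/
def cNext {d : ℕ} (A : Matrix (Fin d) (Fin d) ℝ) (st : State d) : ℝ :=
  gamma1 A st / gamma2 A st

/-- `s_k = β_{k+1} / γ^{(2)}_k` (used if `γ^{(2)}_k ≠ 0`). -/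
def sNext {d : ℕ} (A : Matrix (Fin d) (Fin d) ℝ) (st : State d) : ℝ :=
  betaNext A st / gamma2 A st

/-- `d_k = (v_k - δ^{(2)}_k d_{k-1} - ε_k d_{k-2}) / γ^{(2)}_k` (used if `γ^{(2)}_k ≠ 0`). -/
def dirNext {d : ℕ} (A : Matrix (Fin d) (Fin d) ℝ) (st : State d) : EuclideanSpace ℝ (Fin d) :=
  (gamma2 A st)⁻¹ • (st.v - delta2 A st • st.dir - st.eps • st.dirPrev)

/-- One iteration of MINRES, in which a detected direction of nonpositive curvature does not
terminate the method. A method that has returned a solution stays where it is. If `β_{k+1} = 0`,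
the method returns and no vector `v_{k+1}` is formed; the field `v` is then filled with `0`.
If `γ^{(2)}_k = 0`, it returns and no `d_k` is formed; `dir` is then filled with `0`. -/
def step {d : ℕ} (A : Matrix (Fin d) (Fin d) ℝ) (st : State d) : State d :=
  if st.halted = true then st
  else if gamma2 A st ≠ 0 then
    if betaNext A st ≠ 0 then
      { v := (betaNext A st)⁻¹ • p A st
        vPrev := st.v
        beta := betaNext A st
        delta1 := -st.c * betaNext A st
        eps := st.s * betaNext A st
        c := cNext A st
        s := sNext A st
        phi := sNext A st * st.phi
        tau := cNext A st * st.phi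
        dir := dirNext A st
        dirPrev := st.dir
        x := st.x + (cNext A st * st.phi) • dirNext A st
        r := sNext A st ^ 2 • st.r
          - (sNext A st * st.phi * cNext A st) • ((betaNext A st)⁻¹ • p A st)
        halted := false }
    else
      { v := 0
        vPrev := st.v
        beta := betaNext A st
        delta1 := -st.c * betaNext A st
        eps := st.s * betaNext A st
        c := cNext A st
        s := sNext A st
        phi := sNext A st * st.phi
        tau := cNext A st * st.phi
        dir := dirNext A st
        dirPrev := st.dir
        x := st.x + (cNext A st * st.phi) • dirNext A st
        r := 0
        halted := true }
  else
    { v := 0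
      vPrev := st.v
      beta := betaNext A st
      delta1 := -st.c * betaNext A st
      eps := st.s * betaNext A st
      c := 0
      s := 1
      phi := st.phi
      tau := 0
      dir := 0
      dirPrev := st.dir
      x := st.x
      r := st.r
      halted := true }

/-- The state of MINRES, applied to `A` and `b`, after `k` iterations. -/
def state {d : ℕ} (A : Matrix (Fin d) (Fin d) ℝ) (b : EuclideanSpace ℝ (Fin d)) : ℕ → State d
  | 0 => init b
  | k + 1 => step A (state A b k)

/-- The MINRES iterate `x_k`. -/
def iterate {d : ℕ} (A : Matrix (Fin d) (Fin d) ℝ) (b : EuclideanSpace ℝ (Fin d)) (k : ℕ) :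
    EuclideanSpace ℝ (Fin d) :=
  (state A b k).x

/-- The residual `r_k = b - A x_k`. -/
def residual {d : ℕ} (A : Matrix (Fin d) (Fin d) ℝ) (b : EuclideanSpace ℝ (Fin d)) (k : ℕ) :
    EuclideanSpace ℝ (Fin d) :=
  b - mulVec A (iterate A b k)

/-- The NPC condition `c_{k-1} γ^{(1)}_k ≥ 0`, tested in iteration `k ≥ 1`. -/
def NPCCondition {d : ℕ} (A : Matrix (Fin d) (Fin d) ℝ) (b : EuclideanSpace ℝ (Fin d)) (k : ℕ) :
    Prop :=
  0 ≤ (state A b (k - 1)).c * gamma1 A (state A b (k - 1))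

end Minres

end

namespace Minres

variable {d : ℕ} {A : Matrix (Fin d) (Fin d) ℝ} {b : EuclideanSpace ℝ (Fin d)}

/-! Below the grade the Lanczos vectors are orthonormal, and `r_n = φ_n q_n` with `q_n` a unit
vector and `q_{n+1} = s_{n+1} q_n - c_{n+1} v_{n+2}` (`residual_eq`). Anything in the span of `v_1,
…, v_{n+1}` is orthogonal to `v_{n+2}`, so its inner product with the residual is multiplied by
`s_{n+1}²` from `r_n` to `r_{n+1}` (`inner_residual_succ`). This applies to both `x_n` and
`x_{n+1}`.

What remains is the sign of the increment `c_{n+1} φ_n d_{n+1}` of the iterate against the residual.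
The directions satisfy `γ⁽²⁾_{n+1} c_n d_{n+1} = γ⁽¹⁾_{n+1} s_n d_n - q_n` (`c_smul_dir_succ`).
Pairing with `q_n` and multiplying by `c_n γ⁽¹⁾_{n+1} < 0` gives inductively `c_{n+1} ⟨d_{n+1}, q_n⟩
> 0` (`c_mul_inner_dir_pos`). Hence `⟨x_n, r_n⟩` is positive for `n ≥ 1`, starting from `x_0 = 0`.

Indices: `state A b n` carries `c_n, s_n, φ_n, d_n, x_n` but `v_{n+1}, β_{n+1}`, and `gamma1`,
`gamma2` evaluated there are those of iteration `n + 1`. -/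

lemma mulVec_add (u v : EuclideanSpace ℝ (Fin d)) :
    mulVec A (u + v) = mulVec A u + mulVec A v := map_add _ _ _

lemma mulVec_sub (u v : EuclideanSpace ℝ (Fin d)) :
    mulVec A (u - v) = mulVec A u - mulVec A v := map_sub _ _ _

lemma mulVec_smul (a : ℝ) (u : EuclideanSpace ℝ (Fin d)) :
    mulVec A (a • u) = a • mulVec A u := map_smul _ _ _

lemma mulVec_zero : mulVec A (0 : EuclideanSpace ℝ (Fin d)) = 0 := map_zero _

lemma inner_mulVec_left (hA : A.IsSymm) (u v : EuclideanSpace ℝ (Fin d)) :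
    inner ℝ (mulVec A u) v = inner ℝ u (mulVec A v) := by
  have h : A.IsHermitian := by simpa [Matrix.IsHermitian, Matrix.IsSymm] using hA
  exact Matrix.isSymmetric_toEuclideanLin_iff.2 h u v

lemma mulVec_pow_succ (i : ℕ) (u : EuclideanSpace ℝ (Fin d)) :
    mulVec (A ^ (i + 1)) u = mulVec A (mulVec (A ^ i) u) := by
  simp [mulVec, Matrix.toLpLin_apply, pow_succ']

/-! ### Lanczos recurrence and orthonormality. -/

/-- The Lanczos process has not broken down in the first `k` iterations. -/
def NoBreakdown (A : Matrix (Fin d) (Fin d) ℝ) (b : EuclideanSpace ℝ (Fin d)) (k : ℕ) : Prop :=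
  b ≠ 0 ∧ ∀ i < k, betaNext A (state A b i) ≠ 0

lemma NoBreakdown.mono {k l : ℕ} (h : NoBreakdown A b l) (hkl : k ≤ l) : NoBreakdown A b k :=
  ⟨h.1, fun i hi => h.2 i (hi.trans_le hkl)⟩

lemma gamma2_pos {st : State d} (h : betaNext A st ≠ 0) : 0 < gamma2 A st :=
  Real.sqrt_pos.2 (by positivity)

lemma betaNext_pos {st : State d} (h : betaNext A st ≠ 0) : 0 < betaNext A st :=
  lt_of_le_of_ne (norm_nonneg _) h.symm

lemma step_eq {st : State d} (h : st.halted = false) (hβ : betaNext A st ≠ 0) :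
    step A st =
      { v := (betaNext A st)⁻¹ • p A st
        vPrev := st.v
        beta := betaNext A st
        delta1 := -st.c * betaNext A st
        eps := st.s * betaNext A st
        c := cNext A st
        s := sNext A st
        phi := sNext A st * st.phi
        tau := cNext A st * st.phi
        dir := dirNext A st
        dirPrev := st.dir
        x := st.x + (cNext A st * st.phi) • dirNext A st
        r := sNext A st ^ 2 • st.r
          - (sNext A st * st.phi * cNext A st) • ((betaNext A st)⁻¹ • p A st)
        halted := false } := by
  simp [step, h, hβ, (gamma2_pos hβ).ne']

lemma halted_eq_false {k : ℕ} (h : NoBreakdown A b k) : (state A b k).halted = false := by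
  induction k with
  | zero => rfl
  | succ k ih =>
    rw [state, step_eq (ih (h.mono k.le_succ)) (h.2 k k.lt_succ_self)]

lemma state_succ {k : ℕ} (h : NoBreakdown A b (k + 1)) :
    state A b (k + 1) =
      { v := (betaNext A (state A b k))⁻¹ • p A (state A b k)
        vPrev := (state A b k).v
        beta := betaNext A (state A b k)
        delta1 := -(state A b k).c * betaNext A (state A b k)
        eps := (state A b k).s * betaNext A (state A b k)
        c := cNext A (state A b k)
        s := sNext A (state A b k)
        phi := sNext A (state A b k) * (state A b k).phi
        tau := cNext A (state A b k) * (state A b k).phi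
        dir := dirNext A (state A b k)
        dirPrev := (state A b k).dir
        x := (state A b k).x + (cNext A (state A b k) * (state A b k).phi) •
          dirNext A (state A b k)
        r := sNext A (state A b k) ^ 2 • (state A b k).r
          - (sNext A (state A b k) * (state A b k).phi * cNext A (state A b k)) •
            ((betaNext A (state A b k))⁻¹ • p A (state A b k))
        halted := false } :=
  step_eq (halted_eq_false (h.mono k.le_succ)) (h.2 k k.lt_succ_self)

/-- The Lanczos three-term recurrence. -/
lemma mulVec_v {k : ℕ} (h : NoBreakdown A b (k + 1)) :
    mulVec A (state A b k).v =
      betaNext A (state A b k) • (state A b (k + 1)).v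
        + alpha A (state A b k) • (state A b k).v
        + (state A b k).beta • (state A b k).vPrev := by
  rw [state_succ h, smul_inv_smul₀ (h.2 k k.lt_succ_self), p]
  abel

lemma norm_v {k : ℕ} (h : NoBreakdown A b k) : ‖(state A b k).v‖ = 1 := by
  cases k with
  | zero => simp [state, init, norm_smul, h.1]
  | succ k =>
    have hβ := h.2 k k.lt_succ_self
    rw [state_succ h]
    change ‖(betaNext A (state A b k))⁻¹ • p A (state A b k)‖ = 1
    rw [norm_smul, norm_inv, betaNext, norm_norm]
    exact inv_mul_cancel₀ hβ

lemma inner_v_self {k : ℕ} (h : NoBreakdown A b k) :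
    inner ℝ (state A b k).v (state A b k).v = 1 := by
  rw [real_inner_self_eq_norm_sq, norm_v h, one_pow]

lemma inner_v_of_lt (hA : A.IsSymm) {k : ℕ} (h : NoBreakdown A b k) :
    ∀ j ≤ k, ∀ i < j, inner ℝ (state A b j).v (state A b i).v = 0 := by
  induction k with
  | zero => intro j hj i hi; omega
  | succ n ih =>
    have hn := h.mono n.le_succ
    replace ih := ih hn
    intro j hj i hi
    rcases Nat.lt_or_ge j (n + 1) with hjn | hjn
    · exact ih j (by omega) i hi
    obtain rfl : j = n + 1 := by omega
    have key : betaNext A (state A b n) * inner ℝ (state A b (n + 1)).v (state A b i).v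
        = inner ℝ (mulVec A (state A b n).v) (state A b i).v
          - alpha A (state A b n) * inner ℝ (state A b n).v (state A b i).v
          - (state A b n).beta * inner ℝ (state A b n).vPrev (state A b i).v := by
      rw [mulVec_v h]
      simp only [inner_add_left, real_inner_smul_left]
      ring
    refine (mul_eq_zero.1 (key.trans ?_)).resolve_left (h.2 n n.lt_succ_self)
    have hprev : ∀ i, n ≤ i → i ≤ n → inner ℝ (state A b n).vPrev (state A b i).v = 0 := by
      intro i h1 h2
      obtain rfl : i = n := by omega
      cases i with
      | zero => simp [state, init]
      | succ m =>
        rw [real_inner_comm]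
        conv_lhs => rw [show (state A b (m + 1)).vPrev = (state A b m).v by rw [state_succ hn]]
        exact ih _ le_rfl _ m.lt_succ_self
    rcases Nat.lt_or_ge i n with hin | hin
    · obtain ⟨m, rfl⟩ : ∃ m, n = m + 1 := ⟨n - 1, by omega⟩
      have e1 : (state A b (m + 1)).vPrev = (state A b m).v := by rw [state_succ hn]
      have e2 : (state A b (m + 1)).beta = betaNext A (state A b m) := by rw [state_succ hn]
      have hiv : inner ℝ (state A b (m + 1)).v (state A b i).vPrev = 0 := by
        cases i with
        | zero => simp [state, init]
        | succ l =>
          rw [show (state A b (l + 1)).vPrev = (state A b l).v by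
            rw [state_succ (h.mono (by omega))]]
          exact ih _ le_rfl _ (by omega)
      -- Symmetry moves `A` onto the older vector, where the recurrence reaches only one index
      -- further. The pairing is nonzero only if that index is `m + 1`, and then the `β` term
      -- cancels it.
      rw [inner_mulVec_left hA, mulVec_v (h.mono (show i + 1 ≤ _ by omega)), e1, e2]
      simp only [inner_add_right, real_inner_smul_right]
      rw [hiv, ih (m + 1) le_rfl i hin]
      rcases Nat.lt_or_ge i m with him | him
      · rw [ih (m + 1) le_rfl (i + 1) (by omega), ih m (by omega) i him]
        ring
      · obtain rfl : i = m := by omega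
        rw [inner_v_self hn, inner_v_self (hn.mono i.le_succ)]
        ring
    · obtain rfl : i = n := by omega
      rw [hprev i le_rfl le_rfl, inner_v_self hn, alpha, real_inner_comm]
      ring

/-! ### Lanczos spans and the grade. -/

/-- The span of the Lanczos vectors `v_1, …, v_n`. -/
def lanczosSpan (A : Matrix (Fin d) (Fin d) ℝ) (b : EuclideanSpace ℝ (Fin d)) (n : ℕ) :
    Submodule ℝ (EuclideanSpace ℝ (Fin d)) :=
  Submodule.span ℝ ((fun i => (state A b i).v) '' Set.Iio n)

lemma v_mem_lanczosSpan {i n : ℕ} (h : i < n) : (state A b i).v ∈ lanczosSpan A b n :=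
  Submodule.subset_span ⟨i, h, rfl⟩

lemma lanczosSpan_mono {m n : ℕ} (h : m ≤ n) : lanczosSpan A b m ≤ lanczosSpan A b n :=
  Submodule.span_mono (Set.image_mono (Set.Iio_subset_Iio h))

lemma finrank_lanczosSpan_le (n : ℕ) : Module.finrank ℝ (lanczosSpan A b n) ≤ n := by
  have h : (fun i => (state A b i).v) '' Set.Iio n
      = ((Finset.range n).image (fun i => (state A b i).v) : Finset _) := by
    ext; simp
  rw [lanczosSpan, h]
  exact (finrank_span_finset_le_card _).trans (Finset.card_image_le.trans (by simp))

lemma inner_v_eq_zero (hA : A.IsSymm) {n : ℕ} (h : NoBreakdown A b n)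
    {u : EuclideanSpace ℝ (Fin d)} (hu : u ∈ lanczosSpan A b n) :
    inner ℝ u (state A b n).v = 0 := by
  induction hu using Submodule.span_induction with
  | mem x hx =>
    obtain ⟨i, hi, rfl⟩ := hx
    rw [real_inner_comm]
    exact inner_v_of_lt hA h n le_rfl i hi
  | zero => simp
  | add x y _ _ hx hy => rw [inner_add_left, hx, hy, add_zero]
  | smul a x _ hx => rw [real_inner_smul_left, hx, mul_zero]

lemma vPrev_mem_lanczosSpan {n : ℕ} (h : NoBreakdown A b n) :
    (state A b n).vPrev ∈ lanczosSpan A b n := by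
  cases n with
  | zero => exact Submodule.zero_mem _
  | succ n =>
    rw [show (state A b (n + 1)).vPrev = (state A b n).v by rw [state_succ h]]
    exact v_mem_lanczosSpan n.lt_succ_self

/-- At a breakdown the recurrence produces no new vector, so the span becomes `A`-invariant. -/
lemma mulVec_mem_lanczosSpan {n : ℕ} (h : NoBreakdown A b n)
    (hβ : betaNext A (state A b n) = 0) {u : EuclideanSpace ℝ (Fin d)}
    (hu : u ∈ lanczosSpan A b (n + 1)) : mulVec A u ∈ lanczosSpan A b (n + 1) := by
  induction hu using Submodule.span_induction with
  | mem x hx =>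
    obtain ⟨i, hi, rfl⟩ := hx
    have hi' : i < n + 1 := hi
    have hprev : (state A b i).vPrev ∈ lanczosSpan A b (n + 1) :=
      lanczosSpan_mono hi'.le (vPrev_mem_lanczosSpan (h.mono (by omega)))
    rcases Nat.lt_or_ge i n with hin | hin
    · change mulVec A (state A b i).v ∈ _
      rw [mulVec_v (h.mono hin)]
      exact add_mem (add_mem (Submodule.smul_mem _ _ (v_mem_lanczosSpan (by omega)))
        (Submodule.smul_mem _ _ (v_mem_lanczosSpan hi))) (Submodule.smul_mem _ _ hprev)
    · obtain rfl : i = n := by omega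
      have hp : p A (state A b i) = 0 := norm_eq_zero.1 hβ
      have e : mulVec A (state A b i).v
          = (state A b i).beta • (state A b i).vPrev + alpha A (state A b i) • (state A b i).v := by
        rw [p, sub_sub] at hp
        exact sub_eq_zero.1 hp
      change mulVec A (state A b i).v ∈ _
      rw [e]
      exact add_mem (Submodule.smul_mem _ _ hprev)
        (Submodule.smul_mem _ _ (v_mem_lanczosSpan hi))
  | zero => rw [mulVec_zero]; exact Submodule.zero_mem _
  | add x y _ _ hx hy => rw [mulVec_add]; exact add_mem hx hy
  | smul a x _ hx => rw [mulVec_smul]; exact Submodule.smul_mem _ _ hx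

/-- The Lanczos process does not break down before the grade is reached. -/
lemma IsGrade.noBreakdown {g k : ℕ} (hg : IsGrade A b g) (hk : k < g) : NoBreakdown A b k := by
  have hb : b ≠ 0 := by
    rintro rfl
    have h1 := hg.2 1
    have h0 : krylov A (0 : EuclideanSpace ℝ (Fin d)) 1 = ⊥ := by
      rw [krylov, Submodule.span_eq_bot]
      rintro _ ⟨i, _, rfl⟩
      exact mulVec_zero
    rw [h0, finrank_bot, if_pos (Nat.succ_le_of_lt hg.1)] at h1
    omega
  induction k with
  | zero => exact ⟨hb, fun i hi => absurd hi (Nat.not_lt_zero i)⟩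
  | succ n ih =>
    have hn := ih (by omega)
    refine ⟨hb, fun i hi hβ => ?_⟩
    rcases Nat.lt_or_ge i n with hin | hin
    · exact hn.2 i hin hβ
    obtain rfl : i = n := by omega
    -- The invariant span contains `b`, hence the whole Krylov sequence. As `i + 2 ≤ g`, a Krylov
    -- space of dimension `i + 2` would sit in a space of dimension at most `i + 1`.
    have hpow : ∀ j, mulVec (A ^ j) b ∈ lanczosSpan A b (i + 1) := by
      intro j
      induction j with
      | zero =>
        have e : mulVec (A ^ 0) b = ‖b‖ • (state A b 0).v := by
          simp [mulVec, state, init, smul_smul, hb]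
        rw [e]
        exact Submodule.smul_mem _ _ (v_mem_lanczosSpan i.succ_pos)
      | succ j ihj =>
        rw [mulVec_pow_succ]
        exact mulVec_mem_lanczosSpan hn hβ ihj
    have hle : krylov A b (i + 2) ≤ lanczosSpan A b (i + 1) := by
      rw [krylov, Submodule.span_le]
      rintro _ ⟨j, _, rfl⟩
      exact hpow j
    have h1 := (Submodule.finrank_mono hle).trans (finrank_lanczosSpan_le (i + 1))
    rw [hg.2, if_pos (by omega)] at h1
    omega

/-! ### Rotation coefficients and residual directions. -/

lemma sNext_pos {st : State d} (h : betaNext A st ≠ 0) : 0 < sNext A st :=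
  div_pos (betaNext_pos h) (gamma2_pos h)

lemma cNext_sq_add_sNext_sq {st : State d} (h : betaNext A st ≠ 0) :
    cNext A st ^ 2 + sNext A st ^ 2 = 1 := by
  have h2 : gamma2 A st ^ 2 = gamma1 A st ^ 2 + betaNext A st ^ 2 := Real.sq_sqrt (by positivity)
  rw [cNext, sNext, div_pow, div_pow, ← add_div, ← h2]
  exact div_self (pow_ne_zero 2 (gamma2_pos h).ne')

lemma c_sq_add_s_sq {n : ℕ} (h : NoBreakdown A b n) :
    (state A b n).c ^ 2 + (state A b n).s ^ 2 = 1 := by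
  cases n with
  | zero => simp [state, init]
  | succ n =>
    rw [state_succ h]
    exact cNext_sq_add_sNext_sq (h.2 n n.lt_succ_self)

lemma phi_pos {n : ℕ} (h : NoBreakdown A b n) : 0 < (state A b n).phi := by
  induction n with
  | zero => exact norm_pos_iff.2 h.1
  | succ n ih =>
    rw [state_succ h]
    exact mul_pos (sNext_pos (h.2 n n.lt_succ_self)) (ih (h.mono n.le_succ))

/-- The residual directions, `q_0 = v_1` and `q_n = s_n q_{n-1} - c_n v_{n+1}`. -/
noncomputable def residualDir (A : Matrix (Fin d) (Fin d) ℝ) (b : EuclideanSpace ℝ (Fin d)) :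
    ℕ → EuclideanSpace ℝ (Fin d)
  | 0 => (state A b 0).v
  | n + 1 => (state A b (n + 1)).s • residualDir A b n
      - (state A b (n + 1)).c • (state A b (n + 1)).v

lemma gamma2_smul_dir {n : ℕ} (h : NoBreakdown A b (n + 1)) :
    gamma2 A (state A b n) • (state A b (n + 1)).dir =
      (state A b n).v - delta2 A (state A b n) • (state A b n).dir
        - (state A b n).eps • (state A b n).dirPrev := by
  rw [state_succ h]
  exact smul_inv_smul₀ (gamma2_pos (h.2 n n.lt_succ_self)).ne' _

lemma gamma2_mul_c {n : ℕ} (h : NoBreakdown A b (n + 1)) :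
    gamma2 A (state A b n) * (state A b (n + 1)).c = gamma1 A (state A b n) := by
  rw [state_succ h]
  exact mul_div_cancel₀ _ (gamma2_pos (h.2 n n.lt_succ_self)).ne'

lemma gamma2_mul_s {n : ℕ} (h : NoBreakdown A b (n + 1)) :
    gamma2 A (state A b n) * (state A b (n + 1)).s = betaNext A (state A b n) := by
  rw [state_succ h]
  exact mul_div_cancel₀ _ (gamma2_pos (h.2 n n.lt_succ_self)).ne'

/-- Apply `A` to the direction recurrence and expand `A v` by Lanczos: `h1` and `h2` cancel every
earlier `A d`. They are hypotheses because their own induction, in `v_and_vPrev_expansion`, uses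
this lemma. -/
lemma mulVec_dir_of_expansion {n : ℕ} (h : NoBreakdown A b (n + 1))
    (h1 : (state A b n).v = (state A b n).s • mulVec A (state A b n).dir
      - (state A b n).c • residualDir A b n)
    (h2 : (state A b n).beta • (state A b n).vPrev
      = (state A b n).eps • mulVec A (state A b n).dirPrev
        + (state A b n).delta1 • ((state A b n).c • mulVec A (state A b n).dir
          + (state A b n).s • residualDir A b n)) :
    mulVec A (state A b (n + 1)).dir =
      (state A b (n + 1)).c • residualDir A b n
        + (state A b (n + 1)).s • (state A b (n + 1)).v := by
  have hγ := (gamma2_pos (h.2 n n.lt_succ_self)).ne'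
  apply smul_right_injective _ hγ
  change gamma2 A (state A b n) • _ = gamma2 A (state A b n) • _
  rw [← mulVec_smul, gamma2_smul_dir h, smul_add, smul_smul, smul_smul, gamma2_mul_c h,
    gamma2_mul_s h, mulVec_sub, mulVec_sub, mulVec_smul, mulVec_smul, mulVec_v h, h2]
  have h3 := congrArg (fun u => alpha A (state A b n) • u) h1
  rw [h3, delta2, gamma1]
  module

/-- `v_{n+1}` and `β_{n+1} v_n` in terms of the vectors `A d_i` and the residual directions. -/
lemma v_and_vPrev_expansion {n : ℕ} (h : NoBreakdown A b n) :
    (state A b n).v = (state A b n).s • mulVec A (state A b n).dir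
      - (state A b n).c • residualDir A b n ∧
    (state A b n).beta • (state A b n).vPrev
      = (state A b n).eps • mulVec A (state A b n).dirPrev
        + (state A b n).delta1 • ((state A b n).c • mulVec A (state A b n).dir
          + (state A b n).s • residualDir A b n) := by
  induction n with
  | zero => simp [state, init, residualDir]
  | succ n ih =>
    obtain ⟨h1, h2⟩ := ih (h.mono n.le_succ)
    have hd := mulVec_dir_of_expansion h h1 h2
    have hcs := c_sq_add_s_sq h
    -- The new `A d` and `q` arise from the old `q` and the new `v` through the reflection with rows
    -- `(c, s)` and `(s, -c)`. It is its own inverse, which gives both expansions.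
    rw [hd, residualDir]
    constructor
    · linear_combination (norm := module) (-hcs) • (state A b (n + 1)).v
    · have e : (state A b (n + 1)).c • ((state A b (n + 1)).c • residualDir A b n
          + (state A b (n + 1)).s • (state A b (n + 1)).v)
          + (state A b (n + 1)).s • ((state A b (n + 1)).s • residualDir A b n
          - (state A b (n + 1)).c • (state A b (n + 1)).v) = residualDir A b n := by
        linear_combination (norm := module) hcs • residualDir A b n
      rw [e, state_succ h]
      change betaNext A (state A b n) • (state A b n).v
        = ((state A b n).s * betaNext A (state A b n)) • mulVec A (state A b n).dir
          + (-(state A b n).c * betaNext A (state A b n)) • residualDir A b n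
      linear_combination (norm := module) betaNext A (state A b n) • h1

lemma mulVec_dir {n : ℕ} (h : NoBreakdown A b (n + 1)) :
    mulVec A (state A b (n + 1)).dir =
      (state A b (n + 1)).c • residualDir A b n
        + (state A b (n + 1)).s • (state A b (n + 1)).v :=
  mulVec_dir_of_expansion h (v_and_vPrev_expansion (h.mono n.le_succ)).1
    (v_and_vPrev_expansion (h.mono n.le_succ)).2

lemma iterate_succ {n : ℕ} (h : NoBreakdown A b (n + 1)) :
    iterate A b (n + 1) = iterate A b n
      + ((state A b (n + 1)).c * (state A b n).phi) • (state A b (n + 1)).dir := by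
  rw [iterate, state_succ h]
  rfl

lemma phi_succ {n : ℕ} (h : NoBreakdown A b (n + 1)) :
    (state A b (n + 1)).phi = (state A b (n + 1)).s * (state A b n).phi := by
  rw [state_succ h]

lemma residual_eq {n : ℕ} (h : NoBreakdown A b n) :
    residual A b n = (state A b n).phi • residualDir A b n := by
  induction n with
  | zero => simp [residual, iterate, state, init, residualDir, mulVec_zero, smul_smul, h.1]
  | succ n ih =>
    have hr : residual A b (n + 1) = residual A b n
        - ((state A b (n + 1)).c * (state A b n).phi) • mulVec A (state A b (n + 1)).dir := by
      rw [residual, iterate_succ h, mulVec_add, mulVec_smul, residual]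
      abel
    have hcs := c_sq_add_s_sq h
    rw [hr, ih (h.mono n.le_succ), mulVec_dir h, phi_succ h, residualDir]
    linear_combination (norm := module) (-(state A b n).phi * hcs) • residualDir A b n

/-! ### Two-term recurrence for the search directions. -/

lemma c_smul_dir_succ_of_eq {n : ℕ} (h : NoBreakdown A b (n + 1))
    (hn : (state A b n).c • (state A b n).v + residualDir A b n
      = (state A b n).delta1 • (state A b n).dir
        + ((state A b n).c * (state A b n).eps) • (state A b n).dirPrev) :
    (gamma2 A (state A b n) * (state A b n).c) • (state A b (n + 1)).dir
      = (gamma1 A (state A b n) * (state A b n).s) • (state A b n).dir - residualDir A b n := by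
  have hcs := c_sq_add_s_sq (h.mono n.le_succ)
  rw [mul_comm, mul_smul, gamma2_smul_dir h, delta2, gamma1]
  linear_combination (norm := module) hn - ((state A b n).delta1 * hcs) • (state A b n).dir

/-- For `n ≥ 1` the left side is `s_n q_{n-1}`, which the two-term recurrence one step earlier
expresses through `d_n` and `d_{n-1}`. This eliminates `v` from the three-term recurrence without
dividing by `c_n`. -/
lemma c_smul_v_add_residualDir {n : ℕ} (h : NoBreakdown A b n) :
    (state A b n).c • (state A b n).v + residualDir A b n
      = (state A b n).delta1 • (state A b n).dir
        + ((state A b n).c * (state A b n).eps) • (state A b n).dirPrev := by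
  induction n with
  | zero => simp [state, init, residualDir]
  | succ n ih =>
    have hd := c_smul_dir_succ_of_eq h (ih (h.mono n.le_succ))
    have e1 : (state A b (n + 1)).delta1 = -(state A b n).c * betaNext A (state A b n) := by
      rw [state_succ h]
    have e2 : (state A b (n + 1)).eps = (state A b n).s * betaNext A (state A b n) := by
      rw [state_succ h]
    have e3 : (state A b (n + 1)).dirPrev = (state A b n).dir := by rw [state_succ h]
    rw [← gamma2_mul_c h] at hd
    rw [e1, e2, e3, residualDir, ← gamma2_mul_s h]
    linear_combination (norm := module) (state A b (n + 1)).s • hd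

/-- The conjugate-residual form of the recurrence for the search directions, cleared of
denominators. -/
lemma c_smul_dir_succ {n : ℕ} (h : NoBreakdown A b (n + 1)) :
    (gamma2 A (state A b n) * (state A b n).c) • (state A b (n + 1)).dir
      = (gamma1 A (state A b n) * (state A b n).s) • (state A b n).dir - residualDir A b n :=
  c_smul_dir_succ_of_eq h (c_smul_v_add_residualDir (h.mono n.le_succ))

/-! ### Orthogonality relations for directions, iterates and residuals. -/

lemma dir_mem_lanczosSpan {n : ℕ} (h : NoBreakdown A b n) :
    (state A b n).dir ∈ lanczosSpan A b n ∧ (state A b n).dirPrev ∈ lanczosSpan A b n := by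
  induction n with
  | zero => exact ⟨Submodule.zero_mem _, Submodule.zero_mem _⟩
  | succ n ih =>
    obtain ⟨h1, h2⟩ := ih (h.mono n.le_succ)
    replace h1 := lanczosSpan_mono n.le_succ h1
    replace h2 := lanczosSpan_mono n.le_succ h2
    rw [state_succ h]
    exact ⟨Submodule.smul_mem _ _ (sub_mem (sub_mem (v_mem_lanczosSpan n.lt_succ_self)
      (Submodule.smul_mem _ _ h1)) (Submodule.smul_mem _ _ h2)), h1⟩

lemma iterate_mem_lanczosSpan {n : ℕ} (h : NoBreakdown A b n) :
    iterate A b n ∈ lanczosSpan A b n := by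
  induction n with
  | zero => exact Submodule.zero_mem _
  | succ n ih =>
    rw [iterate_succ h]
    exact add_mem (lanczosSpan_mono n.le_succ (ih (h.mono n.le_succ)))
      (Submodule.smul_mem _ _ (dir_mem_lanczosSpan h).1)

lemma residualDir_mem_lanczosSpan (n : ℕ) : residualDir A b n ∈ lanczosSpan A b (n + 1) := by
  induction n with
  | zero => exact v_mem_lanczosSpan Nat.one_pos
  | succ n ih =>
    exact sub_mem (Submodule.smul_mem _ _ (lanczosSpan_mono (n + 1).le_succ ih))
      (Submodule.smul_mem _ _ (v_mem_lanczosSpan (n + 1).lt_succ_self))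

lemma inner_residualDir_succ (hA : A.IsSymm) {n : ℕ} (h : NoBreakdown A b (n + 1))
    {u : EuclideanSpace ℝ (Fin d)} (hu : u ∈ lanczosSpan A b (n + 1)) :
    inner ℝ u (residualDir A b (n + 1)) = (state A b (n + 1)).s * inner ℝ u (residualDir A b n) := by
  rw [residualDir, inner_sub_right, real_inner_smul_right, real_inner_smul_right,
    inner_v_eq_zero hA h hu, mul_zero, sub_zero]

lemma inner_residualDir_self (hA : A.IsSymm) {n : ℕ} (h : NoBreakdown A b n) :
    inner ℝ (residualDir A b n) (residualDir A b n) = 1 := by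
  induction n with
  | zero => exact inner_v_self h
  | succ n ih =>
    have h1 := inner_v_eq_zero hA h (residualDir_mem_lanczosSpan n)
    have h2 := h1
    rw [real_inner_comm] at h2
    rw [residualDir]
    simp only [inner_sub_left, inner_sub_right, real_inner_smul_left, real_inner_smul_right]
    rw [h1, h2, ih (h.mono n.le_succ), inner_v_self h]
    linear_combination c_sq_add_s_sq h

/-! ### Positivity away from nonpositive curvature. -/

/-- Multiplying `h` by `c γ₁` turns its `-1` into the positive term `-c γ₁` and leaves a nonnegative
multiple of `c a`. -/
lemma c_mul_inner_dir_pos_of_recurrence {γ₁ γ₂ c c' s a a' : ℝ}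
    (hc' : γ₂ * c' = γ₁) (hneg : c * γ₁ < 0) (ha : 0 ≤ c * a)
    (h : γ₂ * c * a' = γ₁ * s * (s * a) - 1) : 0 < c' * a' := by
  have h1 : 0 < (γ₂ * c) ^ 2 * (c' * a') := by
    have e : (γ₂ * c) ^ 2 * (c' * a') = (γ₁ * s) ^ 2 * (c * a) - c * γ₁ := by
      linear_combination (γ₂ * c ^ 2 * a') * hc' + (c * γ₁) * h
    rw [e]
    have := mul_nonneg (sq_nonneg (γ₁ * s)) ha
    linarith
  exact pos_of_mul_pos_right h1 (sq_nonneg _)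

/-- As long as the NPC condition is not met, the search directions have positive curvature,
in the form `c_n ⟨d_n, q_{n-1}⟩ > 0`. -/
lemma c_mul_inner_dir_pos (hA : A.IsSymm) {n : ℕ} (h : NoBreakdown A b (n + 1))
    (hNPC : ∀ i ≤ n, (state A b i).c * gamma1 A (state A b i) < 0) :
    0 < (state A b (n + 1)).c * inner ℝ (state A b (n + 1)).dir (residualDir A b n) := by
  have h' := h.mono n.le_succ
  have e := congrArg (fun u => inner ℝ u (residualDir A b n)) (c_smul_dir_succ h)
  simp only [inner_sub_left, real_inner_smul_left, inner_residualDir_self hA h'] at e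
  induction n with
  | zero =>
    -- The previous pairing is taken as `0`, since `d_0 = 0`.
    refine c_mul_inner_dir_pos_of_recurrence (a := 0) (s := (state A b 0).s) (gamma2_mul_c h)
      (hNPC 0 le_rfl) (by simp) ?_
    rw [e]
    simp [state, init]
  | succ n ih =>
    have h'' := h'.mono n.le_succ
    rw [inner_residualDir_succ hA h' (dir_mem_lanczosSpan h').1] at e
    refine c_mul_inner_dir_pos_of_recurrence (gamma2_mul_c h) (hNPC (n + 1) le_rfl)
      (ih h' (fun i hi => hNPC i (by omega)) h'' ?_).le e
    have e' := congrArg (fun u => inner ℝ u (residualDir A b n)) (c_smul_dir_succ h')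
    simpa only [inner_sub_left, real_inner_smul_left, inner_residualDir_self hA h''] using e'

lemma inner_residual_succ (hA : A.IsSymm) {n : ℕ} (h : NoBreakdown A b (n + 1))
    {u : EuclideanSpace ℝ (Fin d)} (hu : u ∈ lanczosSpan A b (n + 1)) :
    inner ℝ u (residual A b (n + 1)) = (state A b (n + 1)).s ^ 2 * inner ℝ u (residual A b n) := by
  rw [residual_eq h, residual_eq (h.mono n.le_succ), real_inner_smul_right, real_inner_smul_right,
    inner_residualDir_succ hA h hu, phi_succ h]
  ring

lemma s_succ_pos {n : ℕ} (h : NoBreakdown A b (n + 1)) : 0 < (state A b (n + 1)).s := by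
  rw [state_succ h]
  exact sNext_pos (h.2 n n.lt_succ_self)

lemma inner_iterate_residual_lt (hA : A.IsSymm) {n : ℕ} (h : NoBreakdown A b (n + 1))
    (hNPC : ∀ i ≤ n, (state A b i).c * gamma1 A (state A b i) < 0) :
    inner ℝ (iterate A b n) (residual A b (n + 1))
      < inner ℝ (iterate A b (n + 1)) (residual A b (n + 1)) := by
  have h1 := c_mul_inner_dir_pos hA h hNPC
  have hs := s_succ_pos h
  have hφ := phi_pos (h.mono n.le_succ)
  have e : inner ℝ (iterate A b (n + 1)) (residual A b (n + 1))
      = inner ℝ (iterate A b n) (residual A b (n + 1))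
        + ((state A b (n + 1)).s * (state A b n).phi) ^ 2 *
          ((state A b (n + 1)).c * inner ℝ (state A b (n + 1)).dir (residualDir A b n)) := by
    rw [iterate_succ h, inner_add_left, real_inner_smul_left,
      inner_residual_succ hA h (dir_mem_lanczosSpan h).1, residual_eq (h.mono n.le_succ),
      real_inner_smul_right]
    ring
  rw [e]
  exact lt_add_of_pos_right _ (mul_pos (by positivity) h1)

lemma inner_iterate_residual_pos (hA : A.IsSymm) {n : ℕ} (h : NoBreakdown A b (n + 1))
    (hNPC : ∀ i ≤ n, (state A b i).c * gamma1 A (state A b i) < 0) :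
    0 < inner ℝ (iterate A b (n + 1)) (residual A b (n + 1)) := by
  refine lt_of_le_of_lt ?_ (inner_iterate_residual_lt hA h hNPC)
  have h' := h.mono n.le_succ
  rw [inner_residual_succ hA h (lanczosSpan_mono n.le_succ (iterate_mem_lanczosSpan h'))]
  -- What is left is `0 ≤ ⟨x_n, r_n⟩`, proved by induction from `x_0 = 0`.
  refine mul_nonneg (sq_nonneg _) ?_
  induction n with
  | zero => exact (inner_zero_left _).ge
  | succ n ih =>
    have hN : ∀ i ≤ n, (state A b i).c * gamma1 A (state A b i) < 0 :=
      fun i hi => hNPC i (by omega)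
    have h'' := h'.mono n.le_succ
    refine le_trans ?_ (inner_iterate_residual_lt hA h' hN).le
    rw [inner_residual_succ hA h' (lanczosSpan_mono n.le_succ (iterate_mem_lanczosSpan h''))]
    exact mul_nonneg (sq_nonneg _) (ih h' hN h'')

end Minres

theorem mainTheorem4 {d : ℕ} (A : Matrix (Fin d) (Fin d) ℝ) (hA : A.IsSymm)
    (b : EuclideanSpace ℝ (Fin d)) (g : ℕ) (hg : Minres.IsGrade A b g)
    (k : ℕ) (hk1 : 1 ≤ k) (hkg : k < g)
    (hNPC : ∀ i : ℕ, 1 ≤ i → i ≤ k → ¬ Minres.NPCCondition A b i) :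
    (0 < inner ℝ (Minres.iterate A b k) b
        - inner ℝ (Minres.iterate A b k) (Minres.mulVec A (Minres.iterate A b k))) ∧
    (inner ℝ (Minres.iterate A b (k - 1)) (Minres.residual A b k)
        < inner ℝ (Minres.iterate A b k) (Minres.residual A b k) ∧
      0 ≤ inner ℝ (Minres.iterate A b (k - 1)) (Minres.residual A b k) ∧
      (inner ℝ (Minres.iterate A b (k - 1)) (Minres.residual A b k) = 0 ↔ k = 1)) ∧
    (inner ℝ (Minres.iterate A b k) (Minres.residual A b k)
        < inner ℝ (Minres.iterate A b k) (Minres.residual A b (k - 1)) ∧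
      0 < inner ℝ (Minres.iterate A b k) (Minres.residual A b k)) := by
  obtain ⟨n, rfl⟩ : ∃ n, k = n + 1 := ⟨k - 1, by omega⟩
  have h := hg.noBreakdown hkg
  have h' := h.mono n.le_succ
  have hN : ∀ i ≤ n, (Minres.state A b i).c * Minres.gamma1 A (Minres.state A b i) < 0 :=
    fun i hi => not_le.1 (hNPC (i + 1) (by omega) (by omega))
  have hpos := Minres.inner_iterate_residual_pos hA h hN
  have hs := Minres.s_succ_pos h
  have hprev := Minres.inner_residual_succ hA h
    (Minres.lanczosSpan_mono n.le_succ (Minres.iterate_mem_lanczosSpan h'))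
  have hcur := Minres.inner_residual_succ hA h (Minres.iterate_mem_lanczosSpan h)
  rw [Nat.add_sub_cancel]
  refine ⟨?_, ⟨Minres.inner_iterate_residual_lt hA h hN, ?_⟩, ?_, hpos⟩
  -- `⟨x, b⟩ - ⟨x, A x⟩` is `⟨x, r⟩`.
  · rw [← inner_sub_right]
    exact hpos
  · cases n with
    | zero =>
      have e : inner ℝ (Minres.iterate A b 0) (Minres.residual A b (0 + 1)) = 0 :=
        inner_zero_left _
      exact ⟨e.ge, by simpa using e⟩
    | succ n =>
      have hpos' := Minres.inner_iterate_residual_pos hA h' (fun i hi => hN i (by omega))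
      have hlt : 0 < inner ℝ (Minres.iterate A b (n + 1)) (Minres.residual A b (n + 1 + 1)) := by
        rw [hprev]
        positivity
      exact ⟨hlt.le, fun e => absurd e hlt.ne', fun e => by omega⟩
  -- Strict decrease needs `s² < 1`, that is `c ≠ 0`. A zero `c` would force `γ⁽¹⁾ = 0`, which meets
  -- the NPC condition.
  · have hc : (Minres.state A b (n + 1)).c ≠ 0 := by
      intro hc
      have h1 := Minres.gamma2_mul_c h
      have h2 := hN n le_rfl
      rw [← h1, hc, mul_zero, mul_zero] at h2
      exact lt_irrefl _ h2
    have hs1 : (Minres.state A b (n + 1)).s ^ 2 < 1 := by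
      have := Minres.c_sq_add_s_sq h
      have : 0 < (Minres.state A b (n + 1)).c ^ 2 := by positivity
      linarith
    have hpos0 : 0 < inner ℝ (Minres.iterate A b (n + 1)) (Minres.residual A b n) :=
      pos_of_mul_pos_right (hcur ▸ hpos) (sq_nonneg _)
    rw [hcur]
    exact mul_lt_of_lt_one_left hpos0 hs1
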